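/- Let $K\subset\mathbb C$ be compact, let $\mathbb C_\infty=\mathbb C\cup\{\infty\}$ be the Riemann sphere, and let $L\subset\mathbb C_\infty$ contain at least one point from each connected component of $\mathbb C_\infty\setminus K$. Let $O(K)$ be the set of all functions that are holomorphic on some open set containing $K$ (the open set may depend on the function), endowed with $$d(f,g)=\sum_{k=0}^{\infty}\frac1{2^k}\,\frac{\sup_{z\in K}|f^{(k)}(z)-g^{(k)}(z)|}{1+\sup_{z\in K}|f^{(k)}(z)-g^{(k)}(z)|},$$ where functions at distance $0$ (those with the same derivatives of all orders on $K$) are identified and a supremum over the empty set is $0$. Let $B(K)$ be the completion of the metric space $(O(K),d)$, and let $R_L\subset O(K)$ be the set of rational functions all of whose poles in $\mathbb C_\infty$ belong to $L$ and which have no pole on $K$ (the latter is automatic when $L\cap K=\varnothing$). Then $R_L$ is dense in $B(K)$. In particular, for every $f\in O(K)$ there is a sequence $(r_n)$ in $R_L$ such that, for every $l\ge 0$, $r_n^{(l)}\to f^{(l)}$ uniformly on $K$ as $n\to\infty$. -/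

import Mathlib

open TopologicalSpace Filter

noncomputable section

namespace HolNhd

/-- `O(K)`: the functions that are holomorphic on some open set containing the compact set `K`.
A function defined only on an open `V ⊇ K` is represented by any extension of it to `ℂ`; the
metric below only sees the function near `K`, so the choice of the extension is immaterial. -/
def O (K : Compacts ℂ) : Type :=
  {f : ℂ → ℂ // ∃ V : Set ℂ, IsOpen V ∧ (K : Set ℂ) ⊆ V ∧ DifferentiableOn ℂ f V}

variable {K : Compacts ℂ}

instance : CoeFun (O K) (fun _ => ℂ → ℂ) := ⟨fun f => f.1⟩

/-- `sup_{z ∈ K} |f^(k)(z) - g^(k)(z)|`. -/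
def supDist (k : ℕ) (f g : O K) : ℝ :=
  ⨆ z : (K : Set ℂ), ‖iteratedDeriv k f z - iteratedDeriv k g z‖

/-- `d(f, g) = ∑_k 2^(-k) s_k / (1 + s_k)`, with `s_k = sup_{z ∈ K} |f^(k)(z) - g^(k)(z)|`. -/
def d (f g : O K) : ℝ :=
  ∑' k : ℕ, 1 / 2 ^ k * (supDist k f g / (1 + supDist k f g))

theorem continuousOn_iteratedDeriv (k : ℕ) (f : O K) :
    ContinuousOn (iteratedDeriv k f) (K : Set ℂ) := by
  obtain ⟨V, hV, hKV, hf⟩ := f.2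
  have h := (hf.analyticOnNhd hV).iterated_deriv k
  intro z hz
  have := (h z (hKV hz)).continuousAt
  rw [iteratedDeriv_eq_iterate]
  exact this.continuousWithinAt

theorem bddAbove_supDist (k : ℕ) (f g : O K) :
    BddAbove (Set.range fun z : (K : Set ℂ) =>
      ‖iteratedDeriv k f z - iteratedDeriv k g z‖) := by
  have h : ContinuousOn (fun z => ‖iteratedDeriv k f z - iteratedDeriv k g z‖) (K : Set ℂ) :=
    ((continuousOn_iteratedDeriv k f).sub (continuousOn_iteratedDeriv k g)).norm
  have := K.isCompact.bddAbove_image h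
  rwa [Set.image_eq_range] at this

theorem supDist_nonneg (k : ℕ) (f g : O K) : 0 ≤ supDist k f g :=
  Real.iSup_nonneg fun _ => norm_nonneg _

theorem supDist_triangle (k : ℕ) (f g h : O K) :
    supDist k f h ≤ supDist k f g + supDist k g h := by
  refine Real.iSup_le (fun z => ?_) (add_nonneg (supDist_nonneg _ _ _) (supDist_nonneg _ _ _))
  exact (norm_sub_le_norm_sub_add_norm_sub _ (iteratedDeriv k g z) _).trans
    (add_le_add (le_ciSup (bddAbove_supDist k f g) z) (le_ciSup (bddAbove_supDist k g h) z))

theorem summable_d (f g : O K) :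
    Summable fun k : ℕ => 1 / 2 ^ k * (supDist k f g / (1 + supDist k f g)) := by
  have hs : Summable fun k : ℕ => ((1 : ℝ) / 2) ^ k := summable_geometric_two
  refine Summable.of_nonneg_of_le (fun k => ?_) (fun k => ?_) hs
  · have := supDist_nonneg k f g
    positivity
  · have h0 := supDist_nonneg k f g
    rw [one_div_pow]
    refine mul_le_of_le_one_right (by positivity) ?_
    rw [div_le_one (by linarith)]
    linarith

theorem div_one_add_le {a b c : ℝ} (ha : 0 ≤ a) (hb : 0 ≤ b) (hc : 0 ≤ c) (h : a ≤ b + c) :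
    a / (1 + a) ≤ b / (1 + b) + c / (1 + c) := by
  rw [div_add_div _ _ (by positivity) (by positivity), div_le_div_iff₀ (by positivity)
    (by positivity)]
  nlinarith [mul_nonneg hb hc, mul_nonneg (mul_nonneg ha hb) hc]

/-- `O(K)` with the metric `d` (a pseudometric on representatives: `d f g = 0` means that all
derivatives of `f` and `g` agree on `K`). -/
instance : PseudoMetricSpace (O K) where
  dist := d
  dist_self f := by simp [d, supDist]
  dist_comm f g := by simp [d, supDist, norm_sub_rev]
  dist_triangle f g h := by
    simp only [d]
    rw [← (summable_d f g).tsum_add (summable_d g h)]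
    refine (summable_d f h).tsum_le_tsum (fun k => ?_) ((summable_d f g).add (summable_d g h))
    rw [← mul_add]
    exact mul_le_mul_of_nonneg_left (div_one_add_le (supDist_nonneg _ _ _)
      (supDist_nonneg _ _ _) (supDist_nonneg _ _ _) (supDist_triangle _ _ _ _)) (by positivity)

/-- `B(K)`: the (Hausdorff) completion of `O(K)` with respect to `d`. -/
abbrev B (K : Compacts ℂ) : Type := UniformSpace.Completion (O K)

/-- The poles of a rational function on the Riemann sphere: the zeros of the denominator in lowest
terms, and `∞` when the numerator has larger degree than the denominator. -/
def poles (r : RatFunc ℂ) : Set (OnePoint ℂ) :=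
  {a | (∃ z : ℂ, a = (z : OnePoint ℂ) ∧ r.denom.eval z = 0) ∨
    (a = OnePoint.infty ∧ r.denom.natDegree < r.num.natDegree)}

/-- The complement of `K` in the Riemann sphere. -/
def sphereCompl (K : Compacts ℂ) : Set (OnePoint ℂ) :=
  ((fun z : ℂ => (z : OnePoint ℂ)) '' (K : Set ℂ))ᶜ

/-- A rational function without poles on `K`, as an element of `O(K)`. -/
def ofRat (r : RatFunc ℂ) (hr : poles r ⊆ sphereCompl K) : O K :=
  ⟨fun z => r.eval (RingHom.id ℂ) z, {z | r.denom.eval z ≠ 0},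
    isOpen_ne_fun r.denom.continuous continuous_const,
    fun z hz h => hr (Or.inl ⟨z, rfl, h⟩) ⟨z, hz, rfl⟩, by
      intro z hz
      simp only [RatFunc.eval, Polynomial.eval₂_id]
      exact (r.num.differentiableAt.div r.denom.differentiableAt hz).differentiableWithinAt⟩

/-- `R_L`, as a subset of `O(K)`: the rational functions all of whose poles lie in `L` (and that
have no pole on `K`, which is automatic when `L` does not meet `K`). -/
def R (K : Compacts ℂ) (L : Set (OnePoint ℂ)) : Set (O K) :=
  {f | ∃ (r : RatFunc ℂ) (hr : poles r ⊆ sphereCompl K), poles r ⊆ L ∧ f = ofRat r hr}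

end HolNhd

end

/-!
This is Runge's theorem for the topology of uniform convergence on `K` of all derivatives, which is
the topology of the metric `d` (`HolNhd.tendsto_iff`). It suffices that `R_L` is dense in `O(K)`.

Products are continuous in `O(K)`, and two functions with the same germ along `K` are
inseparable, so the closure `E` of `R_L` behaves like a closed algebra of germs. It therefore
contains `(1 - f)⁻¹` whenever it contains `f` and `|f| < 1` on `K`
(`HolNhd.Approximable.inv_one_sub`): the geometric series converges locally uniformly near `K`, and
by Weierstrass' theorem so do its derivatives.

*Pole pushing.* By these geometric series, whether `1 / (z - a)` (or `z`, when `a = ∞`) belongs to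
`E` is a locally constant property of `a` in the complement of `K` in the sphere. It holds at the
points of `L`, one of which lies in each component, so it holds everywhere
(`HolNhd.approximable_poleFun`).

*Cauchy transforms.* Let `f` be holomorphic near `K`, `T` a compact neighbourhood of `K` in its
domain, and `g` the product of `f` with a cutoff function equal to `1` near `T`. The Cauchy–Pompeiu
formula `g(z) = -1/π ∫ (∂g/∂w̄)(w) / (w - z) dw` (`integral_dbar_div_sub`) exhibits `f` on `T` as an
integral over area, convergent in the Banach space `C(T, ℂ)`, of multiples of the functions
`1 / (w - z)` with `w ∉ T`. Hence `f` is a uniform limit on `T` of elements of `E`, holomorphic in the interior of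
`T`, so it is a limit in `O(K)` and belongs to `E`
(`HolNhd.mem_closure_of_approximable_inv_sub`).
-/

open scoped Topology

namespace HolNhd

/-! ### Convergence in `O(K)` -/

variable {K : Compacts ℂ}

theorem supDist_lt_of_dist_lt {l : ℕ} {ε : ℝ} (hε : 0 < ε) {f g : O K}
    (h : dist f g < 1 / 2 ^ l * (ε / (1 + ε))) : supDist l f g < ε := by
  have h0 := supDist_nonneg l f g
  have h1 : 1 / 2 ^ l * (supDist l f g / (1 + supDist l f g)) ≤ dist f g :=
    (summable_d f g).le_tsum l fun j _ => by
      have := supDist_nonneg j f g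
      positivity
  have h2 := lt_of_mul_lt_mul_left (h1.trans_lt h) (by positivity)
  rw [div_lt_div_iff₀ (by positivity) (by positivity)] at h2
  linarith

/-- Convergence for the metric of `O(K)` is uniform convergence on `K` of all derivatives. -/
theorem tendsto_iff {ι : Type*} {p : Filter ι} {F : ι → O K} {f : O K} :
    Tendsto F p (𝓝 f) ↔ ∀ l : ℕ, TendstoUniformlyOn (fun n => iteratedDeriv l (F n))
      (iteratedDeriv l f) p (K : Set ℂ) := by
  constructor
  · intro h l
    rw [Metric.tendstoUniformlyOn_iff]
    intro ε hε
    filter_upwards [Metric.tendsto_nhds.1 h (1 / 2 ^ l * (ε / (1 + ε))) (by positivity)]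
      with n hn z hz
    rw [dist_comm] at hn
    rw [dist_eq_norm]
    exact (le_ciSup (bddAbove_supDist l f (F n)) ⟨z, hz⟩).trans_lt (supDist_lt_of_dist_lt hε hn)
  · intro h
    have hs : ∀ l, Tendsto (fun n => supDist l (F n) f) p (𝓝 0) := by
      intro l
      rw [Metric.tendsto_nhds]
      intro ε hε
      filter_upwards [Metric.tendstoUniformlyOn_iff.1 (h l) (ε / 2) (half_pos hε)] with n hn
      rw [Real.dist_eq, sub_zero, abs_of_nonneg (supDist_nonneg _ _ _)]
      refine lt_of_le_of_lt (Real.iSup_le (fun z => ?_) (half_pos hε).le) (half_lt_self hε)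
      rw [← dist_eq_norm, dist_comm]
      exact (hn z z.2).le
    rw [tendsto_iff_dist_tendsto_zero]
    have key := tendsto_tsum_of_dominated_convergence (𝓕 := p)
      (f := fun n k => 1 / 2 ^ k * (supDist k (F n) f / (1 + supDist k (F n) f)))
      (g := fun _ : ℕ => (0 : ℝ)) (bound := fun k => (1 / 2) ^ k) summable_geometric_two ?_ ?_
    · rw [tsum_zero] at key
      exact key
    · intro k
      have : Tendsto (fun n => 1 / 2 ^ k * (supDist k (F n) f / (1 + supDist k (F n) f))) p
          (𝓝 (1 / 2 ^ k * (0 / (1 + 0)))) :=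
        ((hs k).div (tendsto_const_nhds.add (hs k)) (by norm_num)).const_mul _
      simpa using this
    · refine .of_forall fun n k => ?_
      have h0 := supDist_nonneg k (F n) f
      rw [Real.norm_of_nonneg (by positivity), one_div_pow]
      refine mul_le_of_le_one_right (by positivity) ?_
      rw [div_le_one (by linarith)]
      linarith

theorem analyticAt (f : O K) {z : ℂ} (hz : z ∈ K) : AnalyticAt ℂ f z := by
  obtain ⟨V, hV, hKV, hf⟩ := f.2
  exact hf.analyticAt (hV.mem_nhds (hKV hz))

theorem inseparable_of_eventuallyEq {f g : O K} (h : ∀ z ∈ K, (f : ℂ → ℂ) =ᶠ[𝓝 z] g) :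
    Inseparable f g := by
  have : Tendsto (fun _ : Unit => f) ⊤ (𝓝 g) := by
    refine tendsto_iff.2 fun l => Metric.tendstoUniformlyOn_iff.2 fun ε hε =>
      .of_forall fun _ z hz => ?_
    simpa [(h z hz).iteratedDeriv_eq l] using hε
  have h0 := tendsto_iff_dist_tendsto_zero.1 this
  rw [Metric.inseparable_iff]
  exact tendsto_nhds_unique tendsto_const_nhds h0

/-- Locally uniform convergence of holomorphic functions on a neighbourhood of `K` gives
convergence in `O(K)`, by Weierstrass' theorem on derivatives. -/
theorem tendsto_of_tendstoLocallyUniformlyOn {ι : Type*} {p : Filter ι} {F : ι → O K} {f : O K}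
    {U : Set ℂ} (hU : IsOpen U) (hKU : (K : Set ℂ) ⊆ U)
    (hF : ∀ n, DifferentiableOn ℂ (F n) U)
    (h : TendstoLocallyUniformlyOn (fun n => (F n : ℂ → ℂ)) f p U) : Tendsto F p (𝓝 f) := by
  have key : ∀ l : ℕ, TendstoLocallyUniformlyOn (fun n => iteratedDeriv l (F n))
      (iteratedDeriv l f) p U := by
    intro l
    induction l with
    | zero => simpa using h
    | succ l ih =>
      simp only [iteratedDeriv_succ]
      refine ih.deriv (.of_forall fun n => ?_) hU
      rw [iteratedDeriv_eq_iterate]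
      exact (((hF n).analyticOnNhd hU).iterated_deriv l).differentiableOn
  exact tendsto_iff.2 fun l =>
    (tendstoLocallyUniformlyOn_iff_tendstoUniformlyOn_of_compact K.isCompact).1
      ((key l).mono hKU)

/-! ### Algebraic operations on `O(K)` -/

instance : Add (O K) where
  add f g := ⟨fun z => f z + g z, by
    obtain ⟨V, hV, hKV, hf⟩ := f.2
    obtain ⟨W, hW, hKW, hg⟩ := g.2
    exact ⟨V ∩ W, hV.inter hW, Set.subset_inter hKV hKW,
      (hf.mono Set.inter_subset_left).fun_add (hg.mono Set.inter_subset_right)⟩⟩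

instance : Mul (O K) where
  mul f g := ⟨fun z => f z * g z, by
    obtain ⟨V, hV, hKV, hf⟩ := f.2
    obtain ⟨W, hW, hKW, hg⟩ := g.2
    exact ⟨V ∩ W, hV.inter hW, Set.subset_inter hKV hKW,
      (hf.mono Set.inter_subset_left).fun_mul (hg.mono Set.inter_subset_right)⟩⟩

theorem iteratedDeriv_add_apply (l : ℕ) (f g : O K) {z : ℂ} (hz : z ∈ K) :
    iteratedDeriv l (f + g : O K) z = iteratedDeriv l f z + iteratedDeriv l g z :=
  iteratedDeriv_fun_add (analyticAt f hz).contDiffAt (analyticAt g hz).contDiffAt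

theorem iteratedDeriv_mul_apply (l : ℕ) (f g : O K) {z : ℂ} (hz : z ∈ K) :
    iteratedDeriv l (f * g : O K) z = ∑ i ∈ Finset.range (l + 1),
      (l.choose i : ℂ) * (iteratedDeriv i f z * iteratedDeriv (l - i) g z) := by
  simp_rw [← mul_assoc]
  exact iteratedDeriv_fun_mul (analyticAt f hz).contDiffAt (analyticAt g hz).contDiffAt

theorem continuous_add : Continuous (Function.uncurry fun f g : O K => f + g) := by
  refine continuous_iff_continuousAt.2 fun ⟨f, g⟩ => tendsto_iff.2 fun l => ?_
  have hf := tendsto_iff.1 (continuous_fst.tendsto (f, g)) l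
  have hg := tendsto_iff.1 (continuous_snd.tendsto (f, g)) l
  refine ((hf.add hg).congr_right fun z hz => ?_).congr (.of_forall fun p z hz => ?_)
  · exact (iteratedDeriv_add_apply l f g hz).symm
  · exact (iteratedDeriv_add_apply l p.1 p.2 hz).symm

theorem _root_.tendstoUniformlyOn_finset_sum {ι κ α : Type*} {p : Filter ι} {s : Set α}
    {F : κ → ι → α → ℂ} {f : κ → α → ℂ} (t : Finset κ)
    (h : ∀ i ∈ t, TendstoUniformlyOn (F i) (f i) p s) :
    TendstoUniformlyOn (fun n z => ∑ i ∈ t, F i n z) (fun z => ∑ i ∈ t, f i z) p s := by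
  classical
  induction t using Finset.induction_on with
  | empty =>
    simp only [Finset.sum_empty]
    exact Metric.tendstoUniformlyOn_iff.2 fun ε hε => .of_forall fun _ _ _ => by simpa using hε
  | insert a t ha ih =>
    simp only [Finset.sum_insert ha]
    exact (h a (Finset.mem_insert_self a t)).add
      (ih fun i hi => h i (Finset.mem_insert_of_mem hi))

theorem continuous_mul : Continuous (Function.uncurry fun f g : O K => f * g) := by
  refine continuous_iff_continuousAt.2 fun ⟨f, g⟩ => tendsto_iff.2 fun l => ?_
  have hloc := @tendstoLocallyUniformlyOn_iff_tendstoUniformlyOn_of_compact ℂ ℂ (O K × O K) _ _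
  have hf := fun i => (hloc K.isCompact).2 (tendsto_iff.1 (continuous_fst.tendsto (f, g)) i)
  have hg := fun i => (hloc K.isCompact).2 (tendsto_iff.1 (continuous_snd.tendsto (f, g)) i)
  have hfc := fun i => continuousOn_iteratedDeriv i f
  have hgc := fun i => continuousOn_iteratedDeriv i g
  have hc : ∀ c : ℂ, TendstoLocallyUniformlyOn (fun (_ : O K × O K) (_ : ℂ) => c)
      (fun _ => c) (𝓝 (f, g)) (K : Set ℂ) := fun c =>
    (hloc K.isCompact).2 (Metric.tendstoUniformlyOn_iff.2 fun ε hε =>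
      .of_forall fun _ _ _ => by simpa using hε)
  have key := tendstoUniformlyOn_finset_sum (Finset.range (l + 1)) fun i _ =>
    (hloc K.isCompact).1 ((hc (l.choose i)).fun_mul₀ ((hf i).fun_mul₀ (hg (l - i)) (hfc i)
      (hgc (l - i))) continuousOn_const ((hfc i).fun_mul (hgc (l - i))))
  refine (key.congr_right fun z hz => ?_).congr (.of_forall fun p z hz => ?_)
  · exact (iteratedDeriv_mul_apply l f g hz).symm
  · exact (iteratedDeriv_mul_apply l p.1 p.2 hz).symm

variable {L : Set (OnePoint ℂ)}

/-! ### Rational functions and their poles -/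

theorem infty_mem_poles {r : RatFunc ℂ} : OnePoint.infty ∈ poles r ↔ 0 < r.intDegree := by
  simp [poles, RatFunc.intDegree]

theorem coe_mem_poles {r : RatFunc ℂ} {z : ℂ} :
    (z : OnePoint ℂ) ∈ poles r ↔ r.denom.eval z = 0 := by
  simp [poles]

theorem poles_add_subset (r s : RatFunc ℂ) : poles (r + s) ⊆ poles r ∪ poles s := by
  intro a ha
  induction a using OnePoint.rec with
  | infty =>
    rw [Set.mem_union, infty_mem_poles, infty_mem_poles]
    rw [infty_mem_poles] at ha
    by_cases hs : s = 0
    · left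
      simpa [hs] using ha
    by_cases hrs : r + s = 0
    · simp [hrs] at ha
    · exact lt_max_iff.1 (ha.trans_le (RatFunc.intDegree_add_le hs hrs))
  | coe z =>
    rw [Set.mem_union, coe_mem_poles, coe_mem_poles, ← mul_eq_zero, ← Polynomial.eval_mul]
    exact Polynomial.eval_eq_zero_of_dvd_of_eval_eq_zero (RatFunc.denom_add_dvd r s)
      (coe_mem_poles.1 ha)

theorem poles_mul_subset (r s : RatFunc ℂ) : poles (r * s) ⊆ poles r ∪ poles s := by
  intro a ha
  induction a using OnePoint.rec with
  | infty =>
    rw [Set.mem_union, infty_mem_poles, infty_mem_poles]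
    rw [infty_mem_poles] at ha
    by_cases hr : r = 0
    · simp [hr] at ha
    by_cases hs : s = 0
    · simp [hs] at ha
    rw [RatFunc.intDegree_mul hr hs] at ha
    by_contra! h
    linarith
  | coe z =>
    rw [Set.mem_union, coe_mem_poles, coe_mem_poles, ← mul_eq_zero, ← Polynomial.eval_mul]
    exact Polynomial.eval_eq_zero_of_dvd_of_eval_eq_zero (RatFunc.denom_mul_dvd r s)
      (coe_mem_poles.1 ha)

theorem poles_C (c : ℂ) : poles (RatFunc.C c) = ∅ := by
  ext a
  induction a using OnePoint.rec with
  | infty => simp [infty_mem_poles]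
  | coe z => simp [coe_mem_poles]

theorem poles_X_subset : poles (RatFunc.X : RatFunc ℂ) ⊆ {OnePoint.infty} := by
  intro a ha
  induction a using OnePoint.rec with
  | infty => simp
  | coe z => simp [coe_mem_poles] at ha

theorem poles_inv_X_sub_C_subset (a : ℂ) :
    poles (algebraMap (Polynomial ℂ) (RatFunc ℂ) (Polynomial.X - Polynomial.C a))⁻¹ ⊆
      {(a : OnePoint ℂ)} := by
  intro b hb
  induction b using OnePoint.rec with
  | infty =>
    rw [infty_mem_poles, RatFunc.intDegree_inv, RatFunc.intDegree_polynomial,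
      Polynomial.natDegree_X_sub_C] at hb
    norm_num at hb
  | coe z =>
    have h := RatFunc.denom_div_dvd (1 : Polynomial ℂ) (Polynomial.X - Polynomial.C a)
    rw [map_one, one_div] at h
    have := Polynomial.eval_eq_zero_of_dvd_of_eval_eq_zero h (coe_mem_poles.1 hb)
    rw [Polynomial.eval_sub, Polynomial.eval_X, Polynomial.eval_C, sub_eq_zero] at this
    simp [this]

theorem denom_eval_ne_zero {r : RatFunc ℂ} (hr : poles r ⊆ sphereCompl K) {z : ℂ} (hz : z ∈ K) :
    r.denom.eval z ≠ 0 :=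
  fun h => hr (coe_mem_poles.2 h) ⟨z, hz, rfl⟩

theorem eventually_denom_eval_ne_zero {r : RatFunc ℂ} (hr : poles r ⊆ sphereCompl K) {z : ℂ}
    (hz : z ∈ K) : ∀ᶠ w in 𝓝 z, r.denom.eval w ≠ 0 :=
  r.denom.continuous.continuousAt.eventually_ne (denom_eval_ne_zero hr hz)

/-! ### The closed algebra generated by `R_L` -/

theorem mem_closure_of_eventuallyEq {S : Set (O K)} {f g : O K} (hf : f ∈ closure S)
    (h : ∀ z ∈ K, (f : ℂ → ℂ) =ᶠ[𝓝 z] g) : g ∈ closure S :=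
  ((inseparable_of_eventuallyEq h).mem_closed_iff isClosed_closure).1 hf

theorem add_mem_closure {f g : O K} (hf : f ∈ closure (R K L)) (hg : g ∈ closure (R K L)) :
    f + g ∈ closure (R K L) := by
  rw [← closure_closure]
  refine map_mem_closure₂ continuous_add hf hg ?_
  rintro _ ⟨r, hr, hrL, rfl⟩ _ ⟨s, hs, hsL, rfl⟩
  have h := poles_add_subset r s
  refine mem_closure_of_eventuallyEq (subset_closure
    ⟨r + s, h.trans (Set.union_subset hr hs), h.trans (Set.union_subset hrL hsL), rfl⟩)
    fun z hz => ?_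
  filter_upwards [eventually_denom_eval_ne_zero hr hz, eventually_denom_eval_ne_zero hs hz]
    with w h1 h2
  exact RatFunc.eval_add _ _ (by simpa using! h1) (by simpa using! h2)

theorem mul_mem_closure {f g : O K} (hf : f ∈ closure (R K L)) (hg : g ∈ closure (R K L)) :
    f * g ∈ closure (R K L) := by
  rw [← closure_closure]
  refine map_mem_closure₂ continuous_mul hf hg ?_
  rintro _ ⟨r, hr, hrL, rfl⟩ _ ⟨s, hs, hsL, rfl⟩
  have h := poles_mul_subset r s
  refine mem_closure_of_eventuallyEq (subset_closure
    ⟨r * s, h.trans (Set.union_subset hr hs), h.trans (Set.union_subset hrL hsL), rfl⟩)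
    fun z hz => ?_
  filter_upwards [eventually_denom_eval_ne_zero hr hz, eventually_denom_eval_ne_zero hs hz]
    with w h1 h2
  exact RatFunc.eval_mul _ _ (by simpa using! h1) (by simpa using! h2)

/-- `f` agrees near `K` with a limit in `O(K)` of elements of `R_L`. Working with germs along `K`
makes the values of `f` away from `K`, such as those at poles, irrelevant. -/
def Approximable (K : Compacts ℂ) (L : Set (OnePoint ℂ)) (f : ℂ → ℂ) : Prop :=
  ∃ F ∈ closure (R K L), ∀ z ∈ K, (F : ℂ → ℂ) =ᶠ[𝓝 z] f

namespace Approximable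

variable {f g : ℂ → ℂ}

theorem mem_closure {F : O K} (h : Approximable K L F) : F ∈ closure (R K L) := by
  obtain ⟨G, hG, hGF⟩ := h
  exact mem_closure_of_eventuallyEq hG hGF

theorem congr (hf : Approximable K L f) (h : ∀ z ∈ K, f =ᶠ[𝓝 z] g) : Approximable K L g := by
  obtain ⟨F, hF, hFf⟩ := hf
  exact ⟨F, hF, fun z hz => (hFf z hz).trans (h z hz)⟩

theorem add (hf : Approximable K L f) (hg : Approximable K L g) :
    Approximable K L fun z => f z + g z := by
  obtain ⟨F, hF, hFf⟩ := hf
  obtain ⟨G, hG, hGg⟩ := hg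
  exact ⟨F + G, add_mem_closure hF hG, fun z hz => (hFf z hz).add (hGg z hz)⟩

theorem mul (hf : Approximable K L f) (hg : Approximable K L g) :
    Approximable K L fun z => f z * g z := by
  obtain ⟨F, hF, hFf⟩ := hf
  obtain ⟨G, hG, hGg⟩ := hg
  exact ⟨F * G, mul_mem_closure hF hG, fun z hz => (hFf z hz).mul (hGg z hz)⟩

theorem of_ratFunc (r : RatFunc ℂ) (hr : poles r ⊆ sphereCompl K) (hL : poles r ⊆ L)
    (h : ∀ z ∈ K, (fun z => r.eval (RingHom.id ℂ) z) =ᶠ[𝓝 z] f) : Approximable K L f :=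
  ⟨ofRat r hr, subset_closure ⟨r, hr, hL, rfl⟩, h⟩

theorem const (c : ℂ) : Approximable K L fun _ => c :=
  of_ratFunc (RatFunc.C c) (by simp [poles_C]) (by simp [poles_C]) fun z _ =>
    .of_forall fun w => by simp

theorem id (h : OnePoint.infty ∈ L) : Approximable K L fun z => z :=
  of_ratFunc RatFunc.X
    (poles_X_subset.trans (Set.singleton_subset_iff.2 (by simp [sphereCompl])))
    (poles_X_subset.trans (Set.singleton_subset_iff.2 h)) fun z _ => .of_forall fun w => by simp

theorem inv_sub {a : ℂ} (haK : a ∉ K) (h : (a : OnePoint ℂ) ∈ L) :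
    Approximable K L fun z => (z - a)⁻¹ := by
  have hp := poles_inv_X_sub_C_subset a
  have hr := hp.trans (Set.singleton_subset_iff.2
    (show (a : OnePoint ℂ) ∈ sphereCompl K by simpa [sphereCompl] using haK))
  refine of_ratFunc _ hr (hp.trans (Set.singleton_subset_iff.2 h)) fun z hz => ?_
  have hza : z ≠ a := fun h => haK (h ▸ hz)
  filter_upwards [eventually_denom_eval_ne_zero hr hz, eventually_ne_nhds hza] with w hw hwa
  have h0 : algebraMap (Polynomial ℂ) (RatFunc ℂ) (Polynomial.X - Polynomial.C a) ≠ 0 :=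
    RatFunc.algebraMap_ne_zero (Polynomial.X_sub_C_ne_zero a)
  have h1 := RatFunc.eval_mul (RingHom.id ℂ) w
    (x := (algebraMap (Polynomial ℂ) (RatFunc ℂ) (Polynomial.X - Polynomial.C a))⁻¹)
    (y := algebraMap (Polynomial ℂ) (RatFunc ℂ) (Polynomial.X - Polynomial.C a))
    (by simpa using! hw) (by rw [RatFunc.denom_algebraMap]; simp)
  rw [inv_mul_cancel₀ h0, RatFunc.eval_one, RatFunc.eval_algebraMap] at h1
  refine eq_inv_of_mul_eq_one_left ?_
  simpa using! h1.symm

/-- A closed algebra contains the geometric series of its elements of modulus less than `1`. -/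
theorem inv_one_sub (hf : Approximable K L f) (h : ∀ z ∈ K, ‖f z‖ < 1) :
    Approximable K L fun z => (1 - f z)⁻¹ := by
  obtain ⟨F, hF, hFf⟩ := hf
  obtain ⟨V, hV, hKV, hFV⟩ := F.2
  let U : Set ℂ := V ∩ {z | ‖F z‖ < 1}
  have hU : IsOpen U := hFV.continuousOn.norm.isOpen_inter_preimage hV isOpen_Iio
  have hKU : (K : Set ℂ) ⊆ U := fun z hz => ⟨hKV hz, by
    change ‖F z‖ < 1
    rw [(hFf z hz).eq_of_nhds]
    exact h z hz⟩
  have hFU : DifferentiableOn ℂ F U := hFV.mono Set.inter_subset_left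
  have hS : ∀ N : ℕ, DifferentiableOn ℂ (fun z => ∑ n ∈ Finset.range N, F z ^ n) U := fun N =>
    DifferentiableOn.fun_sum fun n _ => hFU.fun_pow n
  have hinv : DifferentiableOn ℂ (fun z => (1 - F z)⁻¹) U := by
    refine DifferentiableOn.fun_inv (hFU.const_sub 1) fun z hz h0 => ?_
    have : ‖F z‖ < 1 := hz.2
    rw [← sub_eq_zero.1 h0, norm_one] at this
    exact lt_irrefl _ this
  let S : ℕ → O K := fun N => ⟨_, U, hU, hKU, hS N⟩
  let G : O K := ⟨_, U, hU, hKU, hinv⟩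
  have hmem : ∀ N, Approximable K L fun z => ∑ n ∈ Finset.range N, F z ^ n := by
    intro N
    have hFa : Approximable K L F := ⟨F, hF, fun _ _ => .rfl⟩
    induction N with
    | zero => simpa using const (K := K) (L := L) 0
    | succ N ih =>
      refine ((hFa.mul ih).add (const 1)).congr fun z _ => .of_forall fun w => ?_
      simp [Finset.sum_range_succ', Finset.mul_sum, pow_succ']
  have hlim : Tendsto S atTop (𝓝 G) := by
    refine tendsto_of_tendstoLocallyUniformlyOn hU hKU hS ?_
    refine tendstoLocallyUniformlyOn_of_forall_exists_nhds fun z hz => ?_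
    obtain ⟨ρ, hzρ, hρ⟩ := exists_between (show ‖F z‖ < 1 from hz.2)
    have hρ0 : 0 ≤ ρ := (norm_nonneg _).trans hzρ.le
    refine ⟨U ∩ {w | ‖F w‖ < ρ}, mem_nhdsWithin_of_mem_nhds
      ((hFU.continuousOn.norm.isOpen_inter_preimage hU isOpen_Iio).mem_nhds ⟨hz, hzρ⟩), ?_⟩
    have := tendstoUniformlyOn_tsum_nat (f := fun n w => F w ^ n)
      (summable_geometric_of_lt_one hρ0 hρ) (s := U ∩ {w | ‖F w‖ < ρ}) fun n w hw => by
        rw [norm_pow]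
        exact pow_le_pow_left₀ (norm_nonneg _) (le_of_lt hw.2) n
    exact this.congr_right fun w hw => tsum_geometric_of_norm_lt_one (hw.2.trans hρ)
  refine ⟨G, isClosed_closure.mem_of_tendsto hlim (.of_forall fun N => (hmem N).mem_closure),
    fun z hz => ?_⟩
  filter_upwards [hFf z hz] with w hw
  change (1 - F w)⁻¹ = _
  rw [hw]

/-! ### Pushing poles -/

theorem inv_sub_of_inv_sub {a b : ℂ} (haK : a ∉ K) (hab : ∀ z ∈ K, ‖b - a‖ < ‖z - a‖)
    (h : Approximable K L fun z => (z - a)⁻¹) : Approximable K L fun z => (z - b)⁻¹ := by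
  have h1 := ((const (b - a)).mul h).inv_one_sub fun z hz => by
    rw [norm_mul, norm_inv, ← div_eq_mul_inv]
    exact (div_lt_one ((norm_nonneg _).trans_lt (hab z hz))).2 (hab z hz)
  refine (h.mul h1).congr fun z hz => ?_
  filter_upwards [eventually_ne_nhds (show z ≠ a from fun h => haK (h ▸ hz))] with w hw
  have hw' : w - a ≠ 0 := sub_ne_zero.2 hw
  rw [← mul_inv]
  congr 1
  field_simp
  ring

theorem inv_sub_of_id {a : ℂ} (ha : a ≠ 0) (haK : ∀ z ∈ K, ‖z‖ < ‖a‖)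
    (h : Approximable K L fun z => z) : Approximable K L fun z => (z - a)⁻¹ := by
  have h1 := ((const a⁻¹).mul h).inv_one_sub fun z hz => by
    rw [norm_mul, norm_inv, inv_mul_eq_div]
    exact (div_lt_one (norm_pos_iff.2 ha)).2 (haK z hz)
  refine ((const (-a)⁻¹).mul h1).congr fun z hz => .of_forall fun w => ?_
  change (-a)⁻¹ * (1 - a⁻¹ * w)⁻¹ = (w - a)⁻¹
  rw [← mul_inv]
  congr 1
  field_simp
  ring

theorem id_of_inv_sub {a : ℂ} (ha : a ≠ 0) (haK : a ∉ K) (h' : ∀ z ∈ K, ‖z‖ < ‖z - a‖)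
    (h : Approximable K L fun z => (z - a)⁻¹) : Approximable K L fun z => z := by
  -- with `u = (z - a)⁻¹`, the number `1 + a * u = z * u` has modulus less than `1` on `K`
  have h1 := ((const 1).add ((const a).mul h)).inv_one_sub fun z hz => by
    have hza : z - a ≠ 0 := norm_pos_iff.1 ((norm_nonneg _).trans_lt (h' z hz))
    have : 1 + a * (z - a)⁻¹ = z / (z - a) := by
      field_simp
      ring
    rw [this, norm_div]
    exact (div_lt_one (norm_pos_iff.2 hza)).2 (h' z hz)
  refine ((const a).add ((const (-a)).mul h1)).congr fun z hz => ?_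
  filter_upwards [eventually_ne_nhds (show z ≠ a from fun h => haK (h ▸ hz))] with w hw
  have hw' : w - a ≠ 0 := sub_ne_zero.2 hw
  have : (1 - (1 + a * (w - a)⁻¹))⁻¹ = -(w - a) / a := by
    rw [sub_add_cancel_left, ← div_eq_mul_inv, inv_neg, inv_div, neg_div]
  rw [this]
  field_simp
  ring

end Approximable

/-- The standard function with its only pole, a simple one, at `a`: `1 / (z - a)`, or `z` if
`a = ∞`. -/
noncomputable def poleFun (a : OnePoint ℂ) : ℂ → ℂ :=
  a.elim (fun z => z) fun a z => (z - a)⁻¹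

/-- Whether `poleFun a` is approximable is locally constant in `a` outside `K`. -/
theorem eventually_approximable_poleFun_iff {x : OnePoint ℂ} (hx : x ∈ sphereCompl K) :
    ∀ᶠ y in 𝓝 x, Approximable K L (poleFun x) ↔ Approximable K L (poleFun y) := by
  induction x using OnePoint.rec with
  | infty =>
    obtain ⟨M, hM0, hM⟩ := K.isCompact.isBounded.exists_pos_norm_le
    rw [OnePoint.nhds_infty_eq, eventually_sup, eventually_map, eventually_pure,
      coclosedCompact_eq_cocompact]
    refine ⟨?_, Iff.rfl⟩
    filter_upwards [(tendsto_norm_cocompact_atTop (E := ℂ)).eventually_gt_atTop (2 * M)] with a ha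
    have ha0 : a ≠ 0 := norm_pos_iff.1 (by linarith)
    have hlt : ∀ z ∈ K, ‖z‖ < ‖a‖ := fun z hz => by linarith [hM z hz]
    refine ⟨fun h => h.inv_sub_of_id ha0 hlt, fun h => h.id_of_inv_sub ha0
      (fun h => lt_irrefl _ (hlt a h)) fun z hz => ?_⟩
    have := norm_sub_norm_le a z
    rw [norm_sub_rev] at this
    linarith [hM z hz]
  | coe a =>
    have haK : a ∉ K := fun h => hx ⟨a, h, rfl⟩
    obtain ⟨ε, hε, hball⟩ := Metric.isOpen_iff.1 K.isCompact.isClosed.isOpen_compl a haK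
    have hdist : ∀ z ∈ K, ε ≤ ‖z - a‖ := fun z hz => by
      by_contra! h
      exact hball (by rwa [Metric.mem_ball, dist_eq_norm]) hz
    rw [OnePoint.nhds_coe_eq, eventually_map]
    filter_upwards [Metric.ball_mem_nhds a (half_pos hε)] with b hb
    rw [Metric.mem_ball, dist_eq_norm] at hb
    have hbK : b ∉ K := fun h => by linarith [hdist b h]
    refine ⟨fun h => h.inv_sub_of_inv_sub haK fun z hz => by linarith [hdist z hz],
      fun h => h.inv_sub_of_inv_sub hbK fun z hz => ?_⟩
    have := norm_sub_le_norm_sub_add_norm_sub z b a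
    rw [norm_sub_rev a b]
    linarith [hdist z hz]

theorem approximable_poleFun_of_mem {a : OnePoint ℂ} (ha : a ∈ sphereCompl K) (haL : a ∈ L) :
    Approximable K L (poleFun a) := by
  induction a using OnePoint.rec with
  | infty => exact .id haL
  | coe a => exact .inv_sub (fun h => ha ⟨a, h, rfl⟩) haL

/-- Pole pushing: poles can be moved within a component of the complement of `K`. -/
theorem approximable_poleFun (hL : ∀ x ∈ sphereCompl K,
    ∃ a ∈ L, a ∈ connectedComponentIn (sphereCompl K) x) {x : OnePoint ℂ}
    (hx : x ∈ sphereCompl K) : Approximable K L (poleFun x) := by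
  obtain ⟨a, haL, hax⟩ := hL x hx
  have hsub := connectedComponentIn_subset (sphereCompl K) x
  refine (isPreconnected_connectedComponentIn.induction₂
    (fun a b => Approximable K L (poleFun a) ↔ Approximable K L (poleFun b))
    (fun y hy => (eventually_approximable_poleFun_iff (hsub hy)).filter_mono nhdsWithin_le_nhds)
    (fun _ _ _ _ _ _ => Iff.trans) (fun _ _ _ _ => Iff.symm) hax
    (mem_connectedComponentIn hx)).1 (approximable_poleFun_of_mem (hsub hax) haL)

end HolNhd

/-! ### The Cauchy–Pompeiu formula -/

section CauchyPompeiu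

open MeasureTheory Set
open scoped Real

/-- The Wirtinger derivative `∂g/∂z̄ = (∂g/∂x + i ∂g/∂y) / 2`. -/
noncomputable def dbar (g : ℂ → ℂ) (w : ℂ) : ℂ :=
  (fderiv ℝ g w 1 + Complex.I * fderiv ℝ g w Complex.I) / 2

theorem continuous_dbar {g : ℂ → ℂ} (hg : ContDiff ℝ 1 g) : Continuous (dbar g) := by
  have h := hg.continuous_fderiv one_ne_zero
  unfold dbar
  fun_prop

theorem dbar_eq_zero_of_differentiableAt {g : ℂ → ℂ} {w : ℂ} (hg : DifferentiableAt ℂ g w) :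
    dbar g w = 0 := by
  have h : fderiv ℝ g w = (fderiv ℂ g w).restrictScalars ℝ :=
    (hg.hasFDerivAt.restrictScalars ℝ).fderiv
  have h2 : fderiv ℂ g w Complex.I = Complex.I * fderiv ℂ g w 1 := by
    rw [← smul_eq_mul, ← map_smul, smul_eq_mul, mul_one]
  simp only [dbar, h, ContinuousLinearMap.coe_restrictScalars', h2]
  linear_combination (fderiv ℂ g w 1 / 2) * Complex.I_mul_I

theorem hasCompactSupport_dbar {g : ℂ → ℂ} (hg : HasCompactSupport g) :
    HasCompactSupport (dbar g) := by
  refine HasCompactSupport.intro hg fun w hw => ?_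
  have : fderiv ℝ g w = 0 := by
    by_contra h
    exact hw (support_fderiv_subset ℝ h)
  simp [dbar, this]

/-- In polar coordinates around `0` the integrand `∂g/∂z̄ / w` of the Cauchy transform, times the
Jacobian `r`, is `(∂g/∂r + (i/r) ∂g/∂θ) / 2`. The first term integrates along rays to `-g(0)`, the
second along circles to `0`. -/
theorem integral_dbar_div {g : ℂ → ℂ} (hg : ContDiff ℝ 1 g) (hc : HasCompactSupport g) :
    ∫ w, dbar g w / w = -π * g 0 := by
  have hgd : Differentiable ℝ g := hg.differentiable one_ne_zero
  have hD : Continuous (fderiv ℝ g) := hg.continuous_fderiv one_ne_zero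
  let e : ℝ → ℂ := fun θ => Real.cos θ + Real.sin θ * Complex.I
  let e' : ℝ → ℂ := fun θ => -Real.sin θ + Real.cos θ * Complex.I
  have he : Continuous e := by fun_prop
  have he' : Continuous e' := by fun_prop
  have hne : ∀ θ, ‖e θ‖ = 1 := fun θ => by
    simp only [e, Complex.ofReal_cos, Complex.ofReal_sin, ← Complex.exp_mul_I,
      Complex.norm_exp_ofReal_mul_I]
  let A : ℝ × ℝ → ℂ := fun p => fderiv ℝ g (p.1 * e p.2) (e p.2)
  let B : ℝ × ℝ → ℂ := fun p => fderiv ℝ g (p.1 * e p.2) (e' p.2)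
  have hpt : Continuous fun p : ℝ × ℝ => (p.1 : ℂ) * e p.2 := by fun_prop
  have hA : Continuous A := (hD.comp hpt).clm_apply (by fun_prop)
  have hB : Continuous B := (hD.comp hpt).clm_apply (by fun_prop)
  obtain ⟨ρ, hρ⟩ : ∃ ρ : ℝ, ∀ w : ℂ, ρ < ‖w‖ → fderiv ℝ g w = 0 ∧ g w = 0 := by
    obtain ⟨ρ, hρ⟩ := hc.isCompact.isBounded.exists_norm_le
    refine ⟨ρ, fun w hw => ?_⟩
    have hw' : w ∉ tsupport g := fun h => (hρ w h).not_gt hw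
    exact ⟨by_contra fun h => hw' (support_fderiv_subset ℝ h), image_eq_zero_of_notMem_tsupport hw'⟩
  have hvan : ∀ p : ℝ × ℝ, p.1 ∈ Ioi 0 → ρ < p.1 → fderiv ℝ g (p.1 * e p.2) = 0 := by
    intro p hp hρp
    refine (hρ _ ?_).1
    rw [norm_mul, hne, mul_one, Complex.norm_real, Real.norm_of_nonneg (le_of_lt hp)]
    exact hρp
  have hInt : ∀ F : ℝ × ℝ → ℂ, Continuous F →
      (∀ p : ℝ × ℝ, p.1 ∈ Ioi 0 → ρ < p.1 → F p = 0) →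
      IntegrableOn F (Ioi 0 ×ˢ Ioo (-π) π) (volume.prod volume) := by
    intro F hF h0
    have h1 : IntegrableOn F (Icc 0 ρ ×ˢ Icc (-π) π) (volume.prod volume) :=
      hF.continuousOn.integrableOn_compact (isCompact_Icc.prod isCompact_Icc)
    refine h1.of_forall_sdiff_eq_zero (measurableSet_Ioi.prod measurableSet_Ioo) ?_
    rintro ⟨r, θ⟩ ⟨⟨hr, hθ⟩, hn⟩
    refine h0 _ hr (not_le.1 fun h => hn ⟨⟨le_of_lt hr, h⟩, Ioo_subset_Icc_self hθ⟩)
  have hAi := hInt A hA fun p hp h => by simp [A, hvan p hp h]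
  have hBi : IntegrableOn (fun p => B p) (Ioi 0 ×ˢ Ioo (-π) π) (volume.prod volume) :=
    hInt B hB fun p hp h => by simp [B, hvan p hp h]
  -- the radial derivative integrates to `-g 0` along each ray
  have hAint : ∫ p in Ioi 0 ×ˢ Ioo (-π) π, A p ∂(volume.prod volume) = -(2 * π) * g 0 := by
    have hswap : ∫ p in Ioi 0 ×ˢ Ioo (-π) π, A p ∂(volume.prod volume) =
        ∫ θ in Ioo (-π) π, ∫ r in Ioi 0, A (r, θ) := by
      rw [setIntegral_prod _ hAi]
      exact integral_integral_swap (by rwa [Measure.prod_restrict])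
    have hray : ∀ θ, ∫ r in Ioi (0 : ℝ), A (r, θ) = -g 0 := by
      intro θ
      have hd : ∀ r ∈ Ici (0 : ℝ), HasDerivAt (fun r : ℝ => g (r * e θ)) (A (r, θ)) r := by
        intro r _
        have h1 : HasDerivAt (fun r : ℝ => (r : ℂ) * e θ) (e θ) r := by
          simpa using (Complex.ofRealCLM.hasDerivAt (x := r)).mul_const (e θ)
        exact (hgd _).hasFDerivAt.comp_hasDerivAt r h1
      have hi : IntegrableOn (fun r => A (r, θ)) (Ioi (0 : ℝ)) := by
        have h1 : IntegrableOn (fun r => A (r, θ)) (Icc 0 ρ) :=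
          (hA.comp (by fun_prop : Continuous fun r : ℝ => (r, θ))).continuousOn.integrableOn_compact
            isCompact_Icc
        refine h1.of_forall_sdiff_eq_zero measurableSet_Ioi ?_
        rintro r ⟨hr, hn⟩
        have := hvan (r, θ) hr (not_le.1 fun h => hn ⟨le_of_lt hr, h⟩)
        simp only [A, this, zero_apply]
      have ht : Tendsto (fun r : ℝ => g (r * e θ)) atTop (𝓝 0) := by
        refine tendsto_const_nhds.congr' ?_
        filter_upwards [eventually_gt_atTop ρ, eventually_gt_atTop 0] with r hr h0
        refine (hρ _ ?_).2.symm
        rw [norm_mul, hne, mul_one, Complex.norm_real, Real.norm_of_nonneg h0.le]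
        exact hr
      rw [integral_Ioi_of_hasDerivAt_of_tendsto' hd hi ht]
      simp
    rw [hswap]
    simp only [hray, integral_const]
    simp [Real.pi_pos.le, ← two_mul]
  -- the angular derivative integrates to `0` along each circle
  have hBint : ∫ p in Ioi 0 ×ˢ Ioo (-π) π, B p ∂(volume.prod volume) = 0 := by
    rw [setIntegral_prod _ hBi]
    refine setIntegral_eq_zero_of_forall_eq_zero fun r hr => ?_
    have hr0 : (r : ℂ) ≠ 0 := by exact_mod_cast (ne_of_gt hr)
    have hd : ∀ θ ∈ uIcc (-π) π,
        HasDerivAt (fun θ : ℝ => g (r * e θ)) ((r : ℂ) * B (r, θ)) θ := by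
      intro θ _
      have h1 : HasDerivAt e (e' θ) θ := by
        have hc := (Real.hasDerivAt_cos θ).ofReal_comp
        have hs := ((Real.hasDerivAt_sin θ).ofReal_comp).mul_const Complex.I
        simpa [e, e'] using! hc.add hs
      have h2 := (hgd (r * e θ)).hasFDerivAt.comp_hasDerivAt θ (h1.const_mul (r : ℂ))
      have h3 : (r : ℂ) * B (r, θ) = fderiv ℝ g (r * e θ) (r * e' θ) := by
        rw [← Complex.real_smul (z := B (r, θ)), ← Complex.real_smul (z := e' θ), map_smul]
      rw [h3]
      exact h2
    have hcont : Continuous fun θ : ℝ => (r : ℂ) * B (r, θ) :=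
      continuous_const.mul (hB.comp (by fun_prop))
    have h3 := intervalIntegral.integral_eq_sub_of_hasDerivAt hd (hcont.intervalIntegrable _ _)
    rw [intervalIntegral.integral_const_mul, intervalIntegral.integral_of_le
      (by linarith [Real.pi_pos]), integral_Ioc_eq_integral_Ioo] at h3
    have h4 : g (r * e π) - g (r * e (-π)) = 0 := by simp [e]
    exact (mul_eq_zero.1 (h3.trans h4)).resolve_left hr0
  rw [← Complex.integral_comp_polarCoord_symm]
  have hpoint : ∀ p ∈ polarCoord.target,
      p.1 • (dbar g (Complex.polarCoord.symm p) / Complex.polarCoord.symm p) =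
        (A p + Complex.I * B p) / 2 := by
    rintro ⟨r, θ⟩ hp
    have hr : (r : ℂ) ≠ 0 := by exact_mod_cast (ne_of_gt hp.1)
    have hE : Complex.polarCoord.symm (r, θ) = r * e θ := Complex.polarCoord_symm_apply _
    have he0 : e θ ≠ 0 := fun h => by simpa [h] using hne θ
    rw [hE]
    set D := fderiv ℝ g (r * e θ) with hDdef
    have hlin : ∀ a b : ℝ, D (a + b * Complex.I) = a * D 1 + b * D Complex.I := by
      intro a b
      have h : (a + b * Complex.I : ℂ) = a • (1 : ℂ) + b • Complex.I := by simp
      rw [h, map_add, map_smul, map_smul]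
      simp
    have hAv : A (r, θ) = Real.cos θ * D 1 + Real.sin θ * D Complex.I := hlin _ _
    have hBv : B (r, θ) = -Real.sin θ * D 1 + Real.cos θ * D Complex.I := by
      have := hlin (-Real.sin θ) (Real.cos θ)
      push_cast at this ⊢
      simpa [B, e', hDdef] using this
    have hdb : dbar g (r * e θ) = (D 1 + Complex.I * D Complex.I) / 2 := rfl
    rw [hAv, hBv, hdb, Complex.real_smul]
    have hmul : e θ * (Real.cos θ - Real.sin θ * Complex.I) = 1 := by
      have h1 : (Real.cos θ : ℂ) ^ 2 + (Real.sin θ : ℂ) ^ 2 = 1 := by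
        exact_mod_cast Real.cos_sq_add_sin_sq θ
      simp only [e]
      linear_combination h1 - (Real.sin θ : ℂ) ^ 2 * Complex.I_sq
    have hkey : (Real.cos θ * D 1 + Real.sin θ * D Complex.I) +
        Complex.I * (-Real.sin θ * D 1 + Real.cos θ * D Complex.I) =
        (Real.cos θ - Real.sin θ * Complex.I) * (D 1 + Complex.I * D Complex.I) := by
      linear_combination (Real.sin θ * D Complex.I) * Complex.I_sq
    rw [hkey]
    field_simp
    linear_combination (-(D 1 + Complex.I * D Complex.I)) * hmul
  rw [setIntegral_congr_fun polarCoord.open_target.measurableSet hpoint]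
  change ∫ p in Ioi 0 ×ˢ Ioo (-π) π, (A p + Complex.I * B p) / 2 ∂(volume.prod volume) = _
  rw [integral_div, integral_add hAi (hBi.const_mul _), integral_const_mul, hAint, hBint]
  ring

/-- The Cauchy–Pompeiu formula for compactly supported functions. -/
theorem integral_dbar_div_sub {g : ℂ → ℂ} (hg : ContDiff ℝ 1 g) (hc : HasCompactSupport g)
    (z : ℂ) : ∫ w, dbar g w / (w - z) = -π * g z := by
  have h := integral_dbar_div (g := fun w => g (w + z)) (hg.comp (by fun_prop))
    (hc.comp_homeomorph (Homeomorph.addRight z))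
  have hd : ∀ w, dbar (fun w => g (w + z)) w = dbar g (w + z) := fun w => by
    simp only [dbar, fderiv_comp_add_right]
  simp only [hd, zero_add] at h
  rw [← h, ← integral_add_right_eq_self (fun w => dbar g w / (w - z)) z]
  simp

end CauchyPompeiu

namespace HolNhd

variable {K : Compacts ℂ} {L : Set (OnePoint ℂ)}

/-! ### Approximation by Cauchy transforms -/

/-- A holomorphic function on a neighbourhood `V` of the compact set `T` agrees on `T` with a
`C¹` function of compact support whose `∂/∂z̄` vanishes near `T`. -/
theorem exists_contDiff_dbar_eq_zero {f : ℂ → ℂ} {T V : Set ℂ} (hT : IsCompact T) (hV : IsOpen V)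
    (hTV : T ⊆ V) (hf : DifferentiableOn ℂ f V) :
    ∃ g : ℂ → ℂ, ContDiff ℝ 1 g ∧ HasCompactSupport g ∧ (∀ z ∈ T, g z = f z) ∧
      ∃ U, IsOpen U ∧ T ⊆ U ∧ ∀ w ∈ U, dbar g w = 0 := by
  obtain ⟨T', hT', hTT', hT'V⟩ := exists_compact_between hT hV hTV
  obtain ⟨φ, hφ1, hφ0, -⟩ := exists_contMDiffMap_one_nhds_of_subset_interior
    (modelWithCornersSelf ℝ ℂ) (n := 1) hT.isClosed hTT'
  have hφ : ContDiff ℝ 1 φ := φ.contMDiff.contDiff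
  obtain ⟨U, hU, hTU, hU1⟩ := mem_nhdsSet_iff_exists.1 hφ1
  have hfV : ∀ w ∈ V, ContDiffAt ℝ 1 f w := fun w hw =>
    ((hf.contDiffOn hV).contDiffAt (hV.mem_nhds hw)).restrict_scalars ℝ
  refine ⟨fun w => φ w * f w, contDiff_iff_contDiffAt.2 fun w => ?_,
    HasCompactSupport.intro hT' fun w hw => by simp [hφ0 w hw], fun z hz => ?_,
    U ∩ V, hU.inter hV, Set.subset_inter hTU hTV, fun w hw => ?_⟩
  · by_cases hw : w ∈ V
    · exact (Complex.ofRealCLM.contDiff.comp hφ).contDiffAt.mul (hfV w hw)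
    · refine (contDiffAt_const (c := (0 : ℂ))).congr_of_eventuallyEq ?_
      filter_upwards [hT'.isClosed.isOpen_compl.mem_nhds fun h => hw (hT'V h)] with v hv
      simp [hφ0 v hv]
  · have : φ z = 1 := hU1 (hTU hz)
    simp [this]
  · refine dbar_eq_zero_of_differentiableAt
      ((hf.differentiableAt (hV.mem_nhds hw.2)).congr_of_eventuallyEq ?_)
    filter_upwards [hU.mem_nhds hw.1] with v hv
    have : φ v = 1 := hU1 hv
    simp [this]

/-- A Bochner integral of a function with values in a subspace lies in its closure. -/
theorem _root_.Submodule.integral_mem_topologicalClosure {X E : Type*} [MeasurableSpace X]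
    {μ : MeasureTheory.Measure X} [NormedAddCommGroup E] [NormedSpace ℂ E] [CompleteSpace E]
    (N : Submodule ℂ E) {Ψ : X → E} (hΨ : ∀ x, Ψ x ∈ N) (hi : MeasureTheory.Integrable Ψ μ) :
    ∫ x, Ψ x ∂μ ∈ N.topologicalClosure := by
  have : IsClosed (N.topologicalClosure : Set E) := N.isClosed_topologicalClosure
  have h := N.topologicalClosure.mkQL.integral_comp_comm hi
  have h0 : ∀ x, N.topologicalClosure.mkQL (Ψ x) = 0 := fun x =>
    (Submodule.Quotient.mk_eq_zero _).2 (N.le_topologicalClosure (hΨ x))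
  simp only [h0, MeasureTheory.integral_zero] at h
  exact (Submodule.Quotient.mk_eq_zero _).1 h.symm

/-- The continuous functions on `T` that are restrictions of elements of the closure of `R_L` that
are holomorphic in the interior of `T`. -/
def restrictions (K : Compacts ℂ) (L : Set (OnePoint ℂ)) (T : Set ℂ) : Submodule ℂ C(T, ℂ) where
  carrier := {c | ∃ e ∈ closure (R K L), DifferentiableOn ℂ e (interior T) ∧ ∀ z : T, c z = e z}
  add_mem' := by
    rintro c c' ⟨e, he, hd, h⟩ ⟨e', he', hd', h'⟩
    refine ⟨e + e', add_mem_closure he he', hd.add hd', fun z => ?_⟩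
    rw [ContinuousMap.add_apply, h, h']
    rfl
  zero_mem' := by
    let e : O K := ⟨fun _ => 0, Set.univ, isOpen_univ, Set.subset_univ _,
      differentiableOn_const 0⟩
    exact ⟨e, (Approximable.const 0 : Approximable K L e).mem_closure,
      differentiableOn_const 0, fun _ => rfl⟩
  smul_mem' := by
    rintro a c ⟨e, he, hd, h⟩
    let a' : O K := ⟨fun _ => a, Set.univ, isOpen_univ, Set.subset_univ _,
      differentiableOn_const a⟩
    refine ⟨a' * e, mul_mem_closure (Approximable.const a : Approximable K L a').mem_closure he,
      (differentiableOn_const a).mul hd, fun z => ?_⟩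
    rw [ContinuousMap.smul_apply, h]
    rfl

/-- If every `1 / (z - a)` with `a ∉ K` is approximable, so is every `f ∈ O(K)`: on a compact
neighbourhood `T` of `K`, `f` is the Cauchy transform of a continuous function supported off `T`,
and this integral, taken in `C(T, ℂ)`, is a uniform limit of combinations of such functions. -/
theorem mem_closure_of_approximable_inv_sub
    (h : ∀ a ∉ K, Approximable K L fun z => (z - a)⁻¹) (f : O K) : f ∈ closure (R K L) := by
  obtain ⟨V, hV, hKV, hfV⟩ := f.2
  obtain ⟨T, hT, hKT, hTV⟩ := exists_compact_between K.isCompact hV hKV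
  obtain ⟨g, hg, hgc, hgf, U, hU, hTU, hgU⟩ := exists_contDiff_dbar_eq_zero hT hV hTV hfV
  have : CompactSpace T := isCompact_iff_compactSpace.1 hT
  have hgb := continuous_dbar hg
  let Φ : C(ℂ × T, ℂ) := ⟨fun p => dbar g p.1 / (p.1 - p.2), by
    refine continuous_iff_continuousAt.2 fun ⟨w, z⟩ => ?_
    by_cases hwz : w = z
    · have hwU : w ∈ U := hwz ▸ hTU z.2
      refine (continuousAt_const (y := (0 : ℂ))).congr ?_
      filter_upwards [(hU.preimage continuous_fst).mem_nhds hwU] with p hp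
      rw [hgU _ hp, zero_div]
    · exact ContinuousAt.div (by fun_prop) (by fun_prop) (sub_ne_zero.2 hwz)⟩
  let Ψ : C(ℂ, C(T, ℂ)) := Φ.curry
  have hΨ : ∀ w (z : T), Ψ w z = dbar g w / (w - z) := fun _ _ => rfl
  have hΨc : HasCompactSupport Ψ :=
    HasCompactSupport.intro (hasCompactSupport_dbar hgc) fun w hw => by
      ext z
      rw [hΨ, image_eq_zero_of_notMem_tsupport hw, zero_div, ContinuousMap.zero_apply]
  have hΨi : MeasureTheory.Integrable Ψ := Ψ.continuous.integrable_of_hasCompactSupport hΨc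
  have hmem : ∀ w, Ψ w ∈ restrictions K L T := by
    intro w
    by_cases hw : w ∈ U
    · convert (restrictions K L T).zero_mem using 1
      ext z
      rw [hΨ, hgU w hw, zero_div, ContinuousMap.zero_apply]
    have hwT : w ∉ T := fun h => hw (hTU h)
    have hwK : w ∉ K := fun h => hwT (interior_subset (hKT h))
    have hd : DifferentiableOn ℂ (fun z => dbar g w / (w - z)) {w}ᶜ := fun z hz =>
      ((differentiableAt_const _).fun_div (by fun_prop)
        (sub_ne_zero.2 (Ne.symm hz))).differentiableWithinAt
    let e : O K := ⟨_, {w}ᶜ, isOpen_compl_singleton, fun z hz h => hwK (h ▸ hz), hd⟩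
    have he : Approximable K L e :=
      ((Approximable.const (-dbar g w)).mul (h w hwK)).congr fun z _ => .of_forall fun v => by
        change -dbar g w * (v - w)⁻¹ = dbar g w / (w - v)
        rw [← neg_sub w v, inv_neg, neg_mul_neg, div_eq_mul_inv]
    exact ⟨e, he.mem_closure, hd.mono fun z hz h => hwT (h ▸ interior_subset hz), fun z => rfl⟩
  let c : C(T, ℂ) := (-(Real.pi : ℂ))⁻¹ • ∫ w, Ψ w
  have hc : c ∈ (restrictions K L T).topologicalClosure :=
    Submodule.smul_mem _ _ (Submodule.integral_mem_topologicalClosure _ hmem hΨi)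
  have hcf : ∀ z : T, c z = f z := fun z => by
    have hπ : (-(Real.pi : ℂ)) ≠ 0 := neg_ne_zero.2 (by exact_mod_cast Real.pi_ne_zero)
    simp only [c, ContinuousMap.smul_apply]
    rw [ContinuousMap.integral_apply hΨi]
    simp only [hΨ]
    rw [integral_dbar_div_sub hg hgc, smul_eq_mul, inv_mul_cancel_left₀ hπ, hgf z z.2]
  obtain ⟨s, hs, hsc⟩ := mem_closure_iff_seq_limit.1 hc
  choose e he hed hes using hs
  refine isClosed_closure.mem_of_tendsto (f := e) (b := atTop) ?_ (.of_forall he)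
  refine tendsto_of_tendstoLocallyUniformlyOn isOpen_interior hKT hed
    (TendstoUniformlyOn.tendstoLocallyUniformlyOn ?_)
  rw [Metric.tendstoUniformlyOn_iff]
  intro ε hε
  have := ContinuousMap.tendsto_iff_tendstoUniformly.1 hsc
  filter_upwards [Metric.tendstoUniformly_iff.1 this ε hε] with n hn z hz
  have := hn ⟨z, interior_subset hz⟩
  rwa [hcf, hes] at this

/-- Runge's theorem, with convergence of all derivatives: `R_L` is dense in `O(K)` itself, before
the completion is taken. -/
theorem dense_R (hL : ∀ x ∈ sphereCompl K,
    ∃ a ∈ L, a ∈ connectedComponentIn (sphereCompl K) x) : Dense (R K L) :=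
  mem_closure_of_approximable_inv_sub fun a ha =>
    approximable_poleFun hL (x := a) (by simpa [sphereCompl] using ha)

end HolNhd

theorem proposition2p6 (K : TopologicalSpace.Compacts ℂ) (L : Set (OnePoint ℂ))
    (hL : ∀ x ∈ HolNhd.sphereCompl K,
      ∃ a ∈ L, a ∈ connectedComponentIn (HolNhd.sphereCompl K) x) :
    Dense ((fun f : HolNhd.O K => (f : HolNhd.B K)) '' HolNhd.R K L) ∧
    ∀ f : HolNhd.O K, ∃ r : ℕ → HolNhd.O K, (∀ n, r n ∈ HolNhd.R K L) ∧
      ∀ l : ℕ, TendstoUniformlyOn (fun n => iteratedDeriv l (r n)) (iteratedDeriv l f)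
        Filter.atTop (K : Set ℂ) := by
  have hd := HolNhd.dense_R hL
  refine ⟨UniformSpace.Completion.denseRange_coe.dense_image
    (UniformSpace.Completion.continuous_coe _) hd, fun f => ?_⟩
  obtain ⟨r, hr, hrf⟩ := mem_closure_iff_seq_limit.1 (hd f)
  exact ⟨r, hr, HolNhd.tendsto_iff.1 hrf⟩
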